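/- Let $n\ge 1$ and let $S_n$ be the symmetric group with its standard Coxeter generators $s_i=(i\ \,i+1)$, $1\le i\le n-1$, length function $\ell$ and Bruhat order $\le$ (that is, $u\le w$ if and only if some reduced word of $w$ has a subword that is a reduced word of $u$). Products of permutations are composed from right to left. Every $w\in S_n$ has a unique factorization $w=w^{(1)}w^{(2)}\cdots w^{(n-1)}$ in which $w^{(i)}$ belongs to the subgroup generated by $s_1,\dots,s_i$ and $\ell(s_jw^{(i)})>\ell(w^{(i)})$ for all $j<i$; moreover $\ell(w)=\sum_i\ell(w^{(i)})$. Put $$L_n(w)=\bigl(0,\ell(w^{(1)}),\dots,\ell(w^{(n-1)})\bigr).$$ Call $w\in S_n$ \emph{$L_n$-principal} if the sets $\{z\in S_n: L_n(e)\le L_n(z)\le L_n(w)\text{ componentwise}\}$ and $[e,w]=\{z\in S_n: e\le z\le w\}$ coincide. Call a word $x\in\{0,\dots,n-1\}^n$ a \emph{lazy Fubini word} if $x_1=0$ and $x_{i+1}-x_i\le 1$ for all $1\le i\le n-1$. Say that $w$ \emph{avoids $312$} if there are no $i_1<i_2<i_3$ with $w(i_2)<w(i_3)<w(i_1)$. Then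 for every $w\in S_n$ the following are equivalent: 1. $w$ is $L_n$-principal; 2. $L_n(w)$ is a lazy Fubini word; 3. $w$ avoids the pattern $312$. In particular, the number of $L_n$-principal elements of $S_n$ is the $n$-th Catalan number $C_n=\frac{1}{n+1}\binom{2n}{n}$. -/

import Mathlib

namespace LehmerCode

/-! ### A group `W` with a family `s : B → W` of simple generators -/

section Coxeter

variable {B W : Type*} [Group W]

/-- The product of a word in the simple generators. -/
def wordProd (s : B → W) (ω : List B) : W := (ω.map s).prod

/-- The length `ℓ(w)`: the least length of a word in the simple generators with product `w`. -/
noncomputable def length (s : B → W) (w : W) : ℕ :=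
  sInf {l | ∃ ω : List B, ω.length = l ∧ wordProd s ω = w}

/-- `ω` is a reduced word for `w`. -/
def IsReducedWord (s : B → W) (ω : List B) (w : W) : Prop :=
  wordProd s ω = w ∧ ω.length = length s w

/-- The Bruhat order (subword property): some reduced word of `w` has a subword which is a
reduced word of `u`. -/
def BruhatLE (s : B → W) (u w : W) : Prop :=
  ∃ ω : List B, IsReducedWord s ω w ∧ ∃ ω' : List B, ω'.Sublist ω ∧ IsReducedWord s ω' u

/-- The Bruhat interval `[u, v]`. -/
def bruhatInterval (s : B → W) (u v : W) : Set W :=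
  {z | BruhatLE s u z ∧ BruhatLE s z v}

/-- The interval `[u, v]` for the order that a code `L` pulls back from the product
(componentwise) order. -/
def codeInterval {ι : Type*} (L : W → ι → ℕ) (u v : W) : Set W :=
  {z | L u ≤ L z ∧ L z ≤ L v}

/-- `w` is `L`-principal. -/
def IsPrincipal {ι : Type*} (s : B → W) (L : W → ι → ℕ) (w : W) : Prop :=
  codeInterval L 1 w = bruhatInterval s 1 w

/-- The parabolic subgroup `W_J`. -/
def parabolic (s : B → W) (J : Set B) : Subgroup W := Subgroup.closure (s '' J)

/-- The set `ᴵW_J` of those `w ∈ W_J` with `ℓ(s w) > ℓ(w)` for all `s ∈ I`. -/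
def leftQuotient (s : B → W) (I J : Set B) : Set W :=
  {w | w ∈ parabolic s J ∧ ∀ i ∈ I, length s w < length s (s i * w)}

/-- `w = f 0 * f 1 * ⋯ * f (n - 1)` is the parabolic factorization of `w` along the linear order
of the generators: with generators numbered from `0`, the factor `f i` lies in `ᴵW_J` for
`I = {s 0, …, s (i - 1)}` and `J = {s 0, …, s i}`, and the lengths of the factors add up. -/
def IsParabolicFactorization {n : ℕ} (s : Fin n → W) (w : W) (f : Fin n → W) : Prop :=
  (∀ i, f i ∈ leftQuotient s (Set.Iio i) (Set.Iic i)) ∧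
    (List.ofFn f).prod = w ∧ length s w = ∑ i, length s (f i)

/-- The parabolic factorization of `w`. (In a finite Coxeter system it exists and is unique.) -/
noncomputable def parabolicFactor {n : ℕ} (s : Fin n → W) (w : W) : Fin n → W :=
  Classical.epsilon (IsParabolicFactorization s w)

end Coxeter

/-! ### The symmetric group on `n + 1` letters, a Coxeter group of type `A_n` -/

/-- The simple transpositions: `s i` exchanges the letters `i` and `i + 1`. -/
def simple (n : ℕ) (i : Fin n) : Equiv.Perm (Fin (n + 1)) := Equiv.swap i.castSucc i.succ

/-- The code of type `A_n`: the lengths of the factors of the parabolic factorization. -/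
noncomputable def codeA (n : ℕ) (w : Equiv.Perm (Fin (n + 1))) : Fin n → ℕ :=
  fun i => length (simple n) (parabolicFactor (simple n) w i)

/-- The Lehmer code of a permutation of `n + 1` letters: the code of type `A_n`,
preceded by an entry `0`. -/
noncomputable def lehmerCode (n : ℕ) (w : Equiv.Perm (Fin (n + 1))) : Fin (n + 1) → ℕ :=
  Fin.cons 0 (codeA n w)

/-- Lazy Fubini words of length `n + 1`: words in `{0, …, n}` which start with `0`
and never increase by more than one in a step. -/
def IsLazyFubini {n : ℕ} (x : Fin (n + 1) → ℕ) : Prop :=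
  (∀ i, x i < n + 1) ∧ x 0 = 0 ∧ ∀ i : Fin n, x i.succ ≤ x i.castSucc + 1

/-- `σ` avoids the pattern `τ`. -/
def Avoids {m k : ℕ} (σ : Equiv.Perm (Fin m)) (τ : Equiv.Perm (Fin k)) : Prop :=
  ¬ ∃ i : Fin k → Fin m, StrictMono i ∧ StrictMono fun a => σ (i (τ⁻¹ a))

/-- The permutation with one-line notation `312` (letters numbered from `0`: `2, 0, 1`). -/
def perm312 : Equiv.Perm (Fin 3) where
  toFun := ![2, 0, 1]
  invFun := ![1, 2, 0]
  left_inv := by decide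
  right_inv := by decide

end LehmerCode

namespace LehmerCode

open Finset Equiv

variable {m n : ℕ}

/-! The code is a count of inversions: in the factorization, later factors keep small letters in
order and earlier factors fix large ones, so the length of each factor is the number of smaller
letters to the right of one fixed letter (`lehmerCode_eq_invCode`). Concatenating descending words
realizes every code by a reduced word. Shortening these words gives subwords, so code order implies
Bruhat order, and principality is just the converse below `w` (`isPrincipal_iff`).

Principal implies lazy: if the code jumps by at least two, dropping the first letter of a long
descending word leaves a Bruhat-smaller element whose code is too large one entry earlier. Lazy
implies 312-avoiding: in a 312 pattern, lower the largest letter until its code exceeds the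
preceding entry by at least two. Avoiding implies principal: Bruhat order bounds rank counts
(`BruhatLE.rankCount_le`), and for a 312-avoiding `w` these bound the code
(`invCode_le_of_rankCount_le`).

Since the code is injective with image all `x` with `x i ≤ i`, the count is one of lazy words, given
by ballot numbers. -/

/-- The number of letters smaller than `b` which stand to the right of `b` in the one-line
notation of `w`. -/
def invCode (w : Perm (Fin m)) (b : Fin m) : ℕ := #{a | a < b ∧ w⁻¹ b < w⁻¹ a}

/-- The number of inversions. -/
def invNum (w : Perm (Fin m)) : ℕ := ∑ b, invCode w b

/-- The inversions of `w`, as pairs of letters. -/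
def inversions (w : Perm (Fin m)) : Finset (Fin m × Fin m) := {p | p.1 < p.2 ∧ w⁻¹ p.2 < w⁻¹ p.1}

lemma card_inversions (w : Perm (Fin m)) : #(inversions w) = invNum w := by
  simp only [inversions, invNum, invCode, card_filter]
  rw [← univ_product_univ, sum_product_right]

lemma invCode_le (w : Perm (Fin m)) (b : Fin m) : invCode w b ≤ b := by
  calc invCode w b ≤ #(Iio b) := card_le_card (by intro a; simp +contextual)
    _ = b := by simp

@[simp] lemma invCode_one (b : Fin m) : invCode (1 : Perm (Fin m)) b = 0 := by
  simp only [invCode, card_eq_zero, filter_eq_empty_iff]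
  intro a _
  simp only [inv_one, Perm.coe_one, id_eq]
  omega

@[simp] lemma invNum_one : invNum (1 : Perm (Fin m)) = 0 := by simp [invNum]

/-! ### Simple transpositions and the inversion number. -/

lemma simple_mul_self (j : Fin n) : simple n j * simple n j = 1 := by simp [simple]

lemma simple_inv (j : Fin n) : (simple n j)⁻¹ = simple n j := by simp [simple]

lemma simple_apply_val (j : Fin n) (a : Fin (n + 1)) :
    (simple n j a : ℕ) =
      if (a : ℕ) = j then (j : ℕ) + 1 else if (a : ℕ) = (j : ℕ) + 1 then (j : ℕ) else a := by
  simp only [simple, swap_apply_def, Fin.ext_iff, Fin.val_castSucc, Fin.val_succ]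
  split_ifs <;> simp

lemma simple_lt_simple (j : Fin n) {a b : Fin (n + 1)} (h : a < b)
    (hne : ¬ (a = j.castSucc ∧ b = j.succ)) : simple n j a < simple n j b := by
  simp only [Fin.ext_iff, Fin.val_castSucc, Fin.val_succ, Fin.lt_def, simple_apply_val] at *
  split_ifs <;> omega

@[simp] lemma simple_simple (j : Fin n) (a : Fin (n + 1)) : simple n j (simple n j a) = a := by
  simp [simple]

lemma simple_castSucc (j : Fin n) : simple n j j.castSucc = j.succ := by simp [simple]

lemma simple_succ (j : Fin n) : simple n j j.succ = j.castSucc := by simp [simple]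

lemma mem_inversions (w : Perm (Fin m)) (p : Fin m × Fin m) :
    p ∈ inversions w ↔ p.1 < p.2 ∧ w⁻¹ p.2 < w⁻¹ p.1 := by simp [inversions]

/-- A simple transposition preserves the order of every pair of letters except its own, so it
carries the old inversions along and creates exactly one. -/
lemma inversions_simple_mul (j : Fin n) (w : Perm (Fin (n + 1)))
    (h : w⁻¹ j.castSucc < w⁻¹ j.succ) :
    inversions (simple n j * w) = insert (j.castSucc, j.succ)
      ((inversions w).map ((simple n j).toEmbedding.prodMap (simple n j).toEmbedding)) := by
  ext ⟨a, b⟩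
  simp only [mem_insert, mem_map, mem_inversions, mul_inv_rev, Perm.coe_mul, Function.comp_apply,
    simple_inv, Prod.exists, Function.Embedding.coe_prodMap, Equiv.coe_toEmbedding, Prod.map_apply,
    Prod.mk.injEq]
  constructor
  · rintro ⟨hab, hw⟩
    by_cases hne : a = j.castSucc ∧ b = j.succ
    · exact Or.inl hne
    · exact Or.inr ⟨_, _, ⟨simple_lt_simple j hab hne, hw⟩, by simp, by simp⟩
  · rintro (⟨rfl, rfl⟩ | ⟨c, d, ⟨hcd, hw⟩, rfl, rfl⟩)
    · rw [simple_castSucc, simple_succ]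
      exact ⟨Fin.castSucc_lt_succ, h⟩
    · simp only [simple_simple]
      refine ⟨simple_lt_simple j hcd ?_, hw⟩
      rintro ⟨rfl, rfl⟩
      exact absurd hw h.asymm

lemma invNum_simple_mul_of_lt (j : Fin n) (w : Perm (Fin (n + 1)))
    (h : w⁻¹ j.castSucc < w⁻¹ j.succ) : invNum (simple n j * w) = invNum w + 1 := by
  rw [← card_inversions, inversions_simple_mul j w h, card_insert_of_notMem, card_map,
    card_inversions]
  simp only [mem_map, mem_inversions, Prod.exists, Function.Embedding.coe_prodMap,
    Equiv.coe_toEmbedding, Prod.map_apply, Prod.mk.injEq, not_exists, not_and]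
  rintro a b ⟨hab, -⟩ ha hb
  have ha' := congrArg (simple n j) ha
  have hb' := congrArg (simple n j) hb
  rw [simple_simple, simple_castSucc] at ha'
  rw [simple_simple, simple_succ] at hb'
  subst ha' hb'
  exact absurd hab Fin.castSucc_lt_succ.asymm

lemma invNum_simple_mul_of_gt (j : Fin n) (w : Perm (Fin (n + 1)))
    (h : w⁻¹ j.succ < w⁻¹ j.castSucc) : invNum (simple n j * w) + 1 = invNum w := by
  rw [← invNum_simple_mul_of_lt j (simple n j * w), ← mul_assoc, simple_mul_self, one_mul]
  simpa [mul_inv_rev, simple_inv, simple_castSucc, simple_succ] using h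

lemma invNum_lt_simple_mul_iff (j : Fin n) (w : Perm (Fin (n + 1))) :
    invNum w < invNum (simple n j * w) ↔ w⁻¹ j.castSucc < w⁻¹ j.succ := by
  rcases lt_trichotomy (w⁻¹ j.castSucc) (w⁻¹ j.succ) with h | h | h
  · exact iff_of_true (by rw [invNum_simple_mul_of_lt j w h]; omega) h
  · exact absurd (w⁻¹.injective h) Fin.castSucc_lt_succ.ne
  · have := invNum_simple_mul_of_gt j w h
    simp only [h.asymm, iff_false]
    omega

lemma invNum_simple_mul_le (j : Fin n) (w : Perm (Fin (n + 1))) :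
    invNum (simple n j * w) ≤ invNum w + 1 := by
  rcases lt_trichotomy (w⁻¹ j.castSucc) (w⁻¹ j.succ) with h | h | h
  · exact (invNum_simple_mul_of_lt j w h).le
  · exact absurd (w⁻¹.injective h) Fin.castSucc_lt_succ.ne
  · have := invNum_simple_mul_of_gt j w h
    omega

@[simp] lemma wordProd_cons {B W : Type*} [Group W] (s : B → W) (j : B) (ω : List B) :
    wordProd s (j :: ω) = s j * wordProd s ω := by simp [wordProd]

@[simp] lemma wordProd_append {B W : Type*} [Group W] (s : B → W) (ω ω' : List B) :
    wordProd s (ω ++ ω') = wordProd s ω * wordProd s ω' := by simp [wordProd]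

@[simp] lemma wordProd_nil {B W : Type*} [Group W] (s : B → W) : wordProd s [] = 1 := by
  simp [wordProd]

lemma invNum_wordProd_le (ω : List (Fin n)) : invNum (wordProd (simple n) ω) ≤ ω.length := by
  induction ω with
  | nil => simp
  | cons j ω ih =>
    rw [wordProd_cons, List.length_cons]
    exact (invNum_simple_mul_le _ _).trans (by omega)

/-! ### Products of permutations with separated supports -/

/-- `w` fixes every letter above `k`. -/
def FixesAbove (k : ℕ) (w : Perm (Fin m)) : Prop := ∀ a : Fin m, k < a → w a = a

/-- The letters up to `k` occur in increasing order in `w`. -/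
def IncreasingUpTo (k : ℕ) (w : Perm (Fin m)) : Prop :=
  ∀ a b : Fin m, a < b → (b : ℕ) ≤ k → w⁻¹ a < w⁻¹ b

lemma FixesAbove.inv {k : ℕ} {w : Perm (Fin m)} (h : FixesAbove k w) : FixesAbove k w⁻¹ :=
  fun a ha => by rw [Perm.inv_eq_iff_eq, h a ha]

lemma FixesAbove.mul {k : ℕ} {u v : Perm (Fin m)} (hu : FixesAbove k u) (hv : FixesAbove k v) :
    FixesAbove k (u * v) := fun a ha => by rw [Perm.mul_apply, hv a ha, hu a ha]

lemma FixesAbove.mono {k l : ℕ} {w : Perm (Fin m)} (h : FixesAbove k w) (hkl : k ≤ l) :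
    FixesAbove l w := fun a ha => h a (hkl.trans_lt ha)

lemma FixesAbove.apply_le {k : ℕ} {w : Perm (Fin m)} (h : FixesAbove k w) {a : Fin m}
    (ha : (a : ℕ) ≤ k) : (w a : ℕ) ≤ k := by
  by_contra! hlt
  have := w.injective (h _ hlt)
  rw [this] at hlt
  omega

lemma IncreasingUpTo.lt_iff {k : ℕ} {w : Perm (Fin m)} (h : IncreasingUpTo k w) {a b : Fin m}
    (ha : (a : ℕ) ≤ k) (hb : (b : ℕ) ≤ k) : w⁻¹ a < w⁻¹ b ↔ a < b := by
  rcases lt_trichotomy a b with hab | rfl | hab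
  · exact iff_of_true (h a b hab hb) hab
  · simp
  · exact iff_of_false (h b a hab ha).asymm hab.asymm

/-- The inverse of `u` keeps letters up to `k` among themselves, and the inverse of `v` is
increasing there, so `v` does not affect their comparisons. -/
lemma invCode_mul_of_le {k : ℕ} {u v : Perm (Fin m)} (hu : FixesAbove k u)
    (hv : IncreasingUpTo k v) {b : Fin m} (hb : (b : ℕ) ≤ k) :
    invCode (u * v) b = invCode u b := by
  unfold invCode
  congr 1
  ext a
  simp only [mem_filter, mem_univ, true_and, mul_inv_rev, Perm.mul_apply, and_congr_right_iff]
  intro hab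
  exact hv.lt_iff (hu.inv.apply_le hb) (hu.inv.apply_le (by have := Fin.lt_def.1 hab; omega))

lemma FixesAbove.apply_lt_iff {k : ℕ} {w : Perm (Fin m)} (h : FixesAbove k w) {b : Fin m}
    (hb : k < b) (a : Fin m) : w a < b ↔ a < b := by
  simp only [Fin.lt_def]
  by_cases ha : k < a
  · rw [h a ha]
  · have := h.apply_le (a := a) (by omega)
    omega

/-- As `u` fixes `b` and permutes the letters below `b`, it maps the set counted for `v` onto the
one counted for `u * v`. -/
lemma invCode_mul_of_lt {k : ℕ} {u v : Perm (Fin m)} (hu : FixesAbove k u)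
    {b : Fin m} (hb : k < b) :
    invCode (u * v) b = invCode v b := by
  unfold invCode
  rw [← card_map u.toEmbedding (s := filter (fun a => a < b ∧ v⁻¹ b < v⁻¹ a) univ)]
  congr 1
  ext a
  simp only [mem_filter, mem_univ, true_and, mul_inv_rev, Perm.mul_apply, mem_map_equiv,
    hu.inv b hb]
  rw [← Perm.inv_def, hu.inv.apply_lt_iff hb]

lemma IncreasingUpTo.invCode_eq_zero {k : ℕ} {w : Perm (Fin m)} (h : IncreasingUpTo k w)
    {b : Fin m} (hb : (b : ℕ) ≤ k) : invCode w b = 0 := by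
  simp only [invCode, card_eq_zero, filter_eq_empty_iff, not_and]
  intro a _ hab
  exact (h a b hab hb).asymm

lemma FixesAbove.invCode_eq_zero {k : ℕ} {w : Perm (Fin m)} (h : FixesAbove k w)
    {b : Fin m} (hb : k < b) : invCode w b = 0 := by
  rw [← mul_one w, invCode_mul_of_lt h hb, invCode_one]

/-- If `g i` fixes the letters above `i + 1` and keeps those up to `i` in increasing order, then
the code of the product of the `g i` is read off from the factors. -/
lemma prefix_prod_code (g : ℕ → Perm (Fin m)) (N : ℕ)
    (h1 : ∀ i < N, FixesAbove (i + 1) (g i)) (h2 : ∀ i < N, IncreasingUpTo i (g i)) :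
    FixesAbove N ((List.range N).map g).prod ∧
      ∀ i < N, ∀ b : Fin m, (b : ℕ) = i + 1 →
        invCode ((List.range N).map g).prod b = invCode (g i) b := by
  induction N with
  | zero => exact ⟨fun a _ => by simp, fun i hi => by omega⟩
  | succ N ih =>
    obtain ⟨ihf, ihc⟩ := ih (fun i hi => h1 i (by omega)) (fun i hi => h2 i (by omega))
    rw [List.range_succ, List.map_append, List.prod_append, List.map_singleton,
      List.prod_singleton]
    refine ⟨(ihf.mono (by omega)).mul (h1 N (by omega)), fun i hi b hb => ?_⟩
    rcases Nat.lt_succ_iff_lt_or_eq.1 hi with hi | rfl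
    · rw [invCode_mul_of_le ihf (h2 N (by omega)) (by omega), ihc i hi b hb]
    · rw [invCode_mul_of_lt ihf (by omega)]

lemma invCode_zero (w : Perm (Fin (n + 1))) : invCode w 0 = 0 := by
  simpa using invCode_le w 0

lemma invNum_of_factor {i : Fin n} {g : Perm (Fin (n + 1))} (h1 : FixesAbove (i + 1) g)
    (h2 : IncreasingUpTo i g) : invNum g = invCode g i.succ := by
  refine sum_eq_single_of_mem _ (mem_univ _) fun b _ hb => ?_
  rcases lt_or_gt_of_ne (Fin.val_ne_of_ne hb) with h | h <;> rw [Fin.val_succ] at h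
  · exact h2.invCode_eq_zero (by omega)
  · exact h1.invCode_eq_zero h

lemma invCode_prod_ofFn (g : Fin n → Perm (Fin (n + 1)))
    (h1 : ∀ i : Fin n, FixesAbove (i + 1) (g i)) (h2 : ∀ i : Fin n, IncreasingUpTo i (g i))
    (i : Fin n) :
    invCode (List.ofFn g).prod i.succ = invNum (g i) := by
  have key := (prefix_prod_code (fun k => if h : k < n then g ⟨k, h⟩ else 1) n
    (fun i hi => by simpa [hi] using h1 ⟨i, hi⟩) (fun i hi => by simpa [hi] using h2 ⟨i, hi⟩)).2
    i i.2 i.succ (by simp)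
  rw [invNum_of_factor (h1 i) (h2 i)]
  have e : List.ofFn g = (List.range n).map (fun k => if h : k < n then g ⟨k, h⟩ else 1) := by
    apply List.ext_getElem <;> simp +contextual
  rw [e, key]
  simp

/-! ### Descending words, normal forms and length. -/

/-- The word `i, i - 1, …, i - k + 1`. -/
def descWord (i : Fin n) (k : ℕ) : List (Fin n) :=
  (List.range k).map fun t => ⟨i - t, lt_of_le_of_lt (Nat.sub_le _ _) i.2⟩

@[simp] lemma descWord_length (i : Fin n) (k : ℕ) : (descWord i k).length = k := by
  simp [descWord]

lemma descWord_succ (i : Fin n) (k : ℕ) : descWord i (k + 1) =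
    descWord i k ++ [⟨i - k, lt_of_le_of_lt (Nat.sub_le _ _) i.2⟩] := by
  simp [descWord, List.range_succ]

/-- The word drags the letter `i + 1` leftwards past `k` smaller letters, each of which moves one
place to the right. -/
lemma descWord_inv_apply (i : Fin n) (k : ℕ) (hk : k ≤ i + 1) (a : Fin (n + 1)) :
    ((wordProd (simple n) (descWord i k))⁻¹ a : ℕ) =
      if (a : ℕ) ≤ i then (if (a : ℕ) < i + 1 - k then (a : ℕ) else a + 1)
      else if (a : ℕ) = i + 1 then i + 1 - k else a := by
  induction k with
  | zero =>
    simp only [descWord, List.range_zero, List.map_nil, wordProd_nil, inv_one, Perm.one_apply]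
    split_ifs <;> omega
  | succ k ih =>
    rw [descWord_succ, wordProd_append, mul_inv_rev, Perm.mul_apply, wordProd_cons, wordProd_nil,
      mul_one, simple_inv, simple_apply_val, ih (by omega)]
    dsimp only
    split_ifs <;> omega

lemma descWord_fixesAbove (i : Fin n) (k : ℕ) (hk : k ≤ i + 1) :
    FixesAbove (i + 1) (wordProd (simple n) (descWord i k)) := by
  have h : FixesAbove (i + 1) (wordProd (simple n) (descWord i k))⁻¹ := by
    intro a ha
    rw [Fin.ext_iff, descWord_inv_apply i k hk, if_neg (by omega), if_neg (by omega)]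
  simpa using h.inv

lemma descWord_increasingUpTo (i : Fin n) (k : ℕ) (hk : k ≤ i + 1) :
    IncreasingUpTo i (wordProd (simple n) (descWord i k)) := by
  intro a b hab hb
  rw [Fin.lt_def] at hab ⊢
  rw [descWord_inv_apply i k hk, descWord_inv_apply i k hk]
  split_ifs <;> omega

lemma invNum_descWord (i : Fin n) (k : ℕ) (hk : k ≤ i + 1) :
    invNum (wordProd (simple n) (descWord i k)) = k := by
  rw [invNum_of_factor (descWord_fixesAbove i k hk) (descWord_increasingUpTo i k hk), invCode]
  have : filter (fun a => a < i.succ ∧ (wordProd (simple n) (descWord i k))⁻¹ i.succ <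
      (wordProd (simple n) (descWord i k))⁻¹ a) univ =
      Ico (⟨i + 1 - k, by omega⟩ : Fin (n + 1)) i.succ := by
    ext a
    simp only [mem_filter, mem_univ, true_and, Fin.lt_def, descWord_inv_apply i k hk, mem_Ico,
      Fin.le_def, Fin.val_succ]
    split_ifs <;> omega
  rw [this, Fin.card_Ico]
  simp only [Fin.val_succ]
  omega

/-- The word which is the concatenation of the descending words of lengths `x 0, x 1, …`. -/
def codeWord (x : Fin n → ℕ) : List (Fin n) := (List.ofFn fun i => descWord i (x i)).flatten

lemma codeWord_length (x : Fin n → ℕ) : (codeWord x).length = ∑ i, x i := by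
  simp [codeWord, List.sum_ofFn, Function.comp_def]

lemma wordProd_flatten {B W : Type*} [Group W] (s : B → W) (l : List (List B)) :
    wordProd s l.flatten = (l.map (wordProd s)).prod := by
  induction l with
  | nil => simp
  | cons a l ih => simp [ih]

lemma wordProd_codeWord (x : Fin n → ℕ) : wordProd (simple n) (codeWord x) =
    (List.ofFn fun i => wordProd (simple n) (descWord i (x i))).prod := by
  rw [codeWord, wordProd_flatten, List.map_ofFn]
  rfl

lemma invCode_codeWord (x : Fin n → ℕ) (hx : ∀ i : Fin n, x i ≤ i + 1) (i : Fin n) :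
    invCode (wordProd (simple n) (codeWord x)) i.succ = x i := by
  rw [wordProd_codeWord, invCode_prod_ofFn _ (fun i => descWord_fixesAbove i _ (hx i))
    (fun i => descWord_increasingUpTo i _ (hx i)), invNum_descWord i _ (hx i)]

lemma exists_invCode_eq (x : Fin (n + 1) → ℕ) (hx : ∀ i, x i ≤ i) :
    ∃ w : Perm (Fin (n + 1)), invCode w = x := by
  refine ⟨wordProd (simple n) (codeWord fun i => x i.succ), funext fun i => ?_⟩
  induction i using Fin.cases with
  | zero => exact (invCode_zero _).trans (by simpa [eq_comm] using hx 0)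
  | succ i => exact invCode_codeWord _ (fun i => by simpa using hx i.succ) i

/-- Codes surject onto a product of sets of sizes `1, …, n + 1`, which has as many elements as there
are permutations. -/
lemma invCode_injective : Function.Injective (invCode : Perm (Fin (n + 1)) → Fin (n + 1) → ℕ) := by
  let F : Perm (Fin (n + 1)) → (i : Fin (n + 1)) → Fin (i + 1) :=
    fun w i => ⟨invCode w i, Nat.lt_succ_of_le (invCode_le w i)⟩
  have hF : Function.Bijective F := by
    rw [Fintype.bijective_iff_surjective_and_card]
    constructor
    · intro x
      obtain ⟨w, hw⟩ := exists_invCode_eq (fun i => (x i : ℕ)) fun i => Nat.lt_succ_iff.1 (x i).2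
      exact ⟨w, funext fun i => Fin.ext (congrFun hw i)⟩
    · simp only [Fintype.card_perm, Fintype.card_fin, Fintype.card_pi]
      rw [Fin.prod_univ_eq_prod_range (fun i => i + 1), prod_range_add_one_eq_factorial]
  intro u v h
  exact hF.1 (funext fun i => Fin.ext (congrFun h i))

/-- The word of a permutation given by its code. -/
def normalWord (w : Perm (Fin (n + 1))) : List (Fin n) := codeWord fun i => invCode w i.succ

lemma wordProd_normalWord (w : Perm (Fin (n + 1))) :
    wordProd (simple n) (normalWord w) = w := by
  refine invCode_injective (funext fun i => ?_)
  induction i using Fin.cases with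
  | zero => rw [invCode_zero, invCode_zero]
  | succ i => exact invCode_codeWord _ (fun i => by simpa using invCode_le w i.succ) i

lemma normalWord_length (w : Perm (Fin (n + 1))) : (normalWord w).length = invNum w := by
  rw [normalWord, codeWord_length, invNum, Fin.sum_univ_succ, invCode_zero, zero_add]

lemma length_eq_invNum (w : Perm (Fin (n + 1))) : length (simple n) w = invNum w := by
  apply le_antisymm
  · exact Nat.sInf_le ⟨normalWord w, normalWord_length w, wordProd_normalWord w⟩
  · refine le_csInf ⟨_, normalWord w, normalWord_length w, wordProd_normalWord w⟩ ?_
    rintro _ ⟨ω, rfl, rfl⟩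
    exact invNum_wordProd_le ω

lemma isReducedWord_normalWord (w : Perm (Fin (n + 1))) :
    IsReducedWord (simple n) (normalWord w) w :=
  ⟨wordProd_normalWord w, by rw [normalWord_length, length_eq_invNum]⟩

/-! ### The parabolic factorization -/

lemma fixesAbove_of_mem_parabolic {i : Fin n} {w : Perm (Fin (n + 1))}
    (h : w ∈ parabolic (simple n) (Set.Iic i)) : FixesAbove (i + 1) w := by
  induction h using Subgroup.closure_induction with
  | mem x hx =>
    obtain ⟨j, hj, rfl⟩ := hx
    intro a ha
    rw [Fin.ext_iff, simple_apply_val]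
    have := Fin.le_def.1 hj
    split_ifs <;> omega
  | one => exact fun a _ => rfl
  | mul x y _ _ hx hy => exact hx.mul hy
  | inv x _ hx => exact hx.inv

lemma increasingUpTo_of_forall {k : ℕ} {w : Perm (Fin (n + 1))}
    (h : ∀ j : Fin n, (j : ℕ) < k → w⁻¹ j.castSucc < w⁻¹ j.succ) : IncreasingUpTo k w := by
  intro a b hab hb
  induction b using Fin.induction with
  | zero => exact absurd hab (Fin.not_lt_zero a)
  | succ b ih =>
    have hb' : (b : ℕ) < k := by simpa using hb
    rcases (Fin.le_castSucc_iff.2 hab).lt_or_eq with h' | rfl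
    · exact (ih h' (by simpa using hb'.le)).trans (h b hb')
    · exact h b hb'

/-- A left ascent at `j` says that the letter `j` precedes `j + 1`; chaining these gives the
increasing order. -/
lemma mem_leftQuotient_iff {i : Fin n} {w : Perm (Fin (n + 1))} :
    w ∈ leftQuotient (simple n) (Set.Iio i) (Set.Iic i) ↔
      w ∈ parabolic (simple n) (Set.Iic i) ∧ IncreasingUpTo i w := by
  simp only [leftQuotient, Set.mem_ofPred_eq, length_eq_invNum, invNum_lt_simple_mul_iff,
    Set.mem_Iio, and_congr_right_iff]
  refine fun _ => ⟨fun h => increasingUpTo_of_forall fun j hj => h j hj, fun h j hj => ?_⟩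
  exact h _ _ Fin.castSucc_lt_succ (by simpa using Nat.succ_le_of_lt hj)

lemma wordProd_mem_parabolic {J : Set (Fin n)} {ω : List (Fin n)} (h : ∀ j ∈ ω, j ∈ J) :
    wordProd (simple n) ω ∈ parabolic (simple n) J := by
  refine Subgroup.list_prod_mem _ fun x hx => ?_
  obtain ⟨j, hj, rfl⟩ := List.mem_map.1 hx
  exact Subgroup.subset_closure ⟨j, h j hj, rfl⟩

lemma descWord_mem_leftQuotient (i : Fin n) (k : ℕ) (hk : k ≤ i + 1) :
    wordProd (simple n) (descWord i k) ∈ leftQuotient (simple n) (Set.Iio i) (Set.Iic i) := by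
  refine mem_leftQuotient_iff.2 ⟨wordProd_mem_parabolic fun j hj => ?_,
    descWord_increasingUpTo i k hk⟩
  obtain ⟨t, -, rfl⟩ := List.mem_map.1 hj
  simp [Fin.le_def]

lemma isParabolicFactorization_descWord (w : Perm (Fin (n + 1))) :
    IsParabolicFactorization (simple n) w
      fun i => wordProd (simple n) (descWord i (invCode w i.succ)) := by
  have hle (i : Fin n) : invCode w i.succ ≤ i + 1 := by simpa using invCode_le w i.succ
  refine ⟨fun i => descWord_mem_leftQuotient i _ (hle i), ?_, ?_⟩
  · rw [← wordProd_codeWord]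
    exact wordProd_normalWord w
  · simp only [length_eq_invNum, invNum_descWord _ _ (hle _)]
    rw [invNum, Fin.sum_univ_succ, invCode_zero, zero_add]

lemma IsParabolicFactorization.length_eq {w : Perm (Fin (n + 1))} {f : Fin n → Perm (Fin (n + 1))}
    (h : IsParabolicFactorization (simple n) w f) (i : Fin n) :
    length (simple n) (f i) = invCode w i.succ := by
  rw [length_eq_invNum, ← h.2.1, invCode_prod_ofFn f
    (fun i => fixesAbove_of_mem_parabolic (mem_leftQuotient_iff.1 (h.1 i)).1)
    (fun i => (mem_leftQuotient_iff.1 (h.1 i)).2)]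

/-- Every factorization has the same factor lengths, so existence alone suffices to evaluate the
`epsilon` choice. -/
lemma lehmerCode_eq_invCode (w : Perm (Fin (n + 1))) : lehmerCode n w = invCode w := by
  have h : IsParabolicFactorization (simple n) w (parabolicFactor (simple n) w) :=
    Classical.epsilon_spec ⟨_, isParabolicFactorization_descWord w⟩
  funext i
  induction i using Fin.cases with
  | zero => simp [lehmerCode, invCode_zero]
  | succ i => simpa [lehmerCode, codeA] using h.length_eq i

/-! ### The code order is weaker than the Bruhat order -/

lemma descWord_sublist {i : Fin n} {k l : ℕ} (h : k ≤ l) : (descWord i k).Sublist (descWord i l) :=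
  (List.range_sublist.2 h).map _

lemma descWord_sublist_succ {i j : Fin n} (hij : (j : ℕ) = i + 1) {k l : ℕ} (h : k + 1 ≤ l) :
    (descWord i k).Sublist (descWord j l) := by
  refine List.Sublist.trans ?_ (descWord_sublist h)
  -- Since `j = i + 1`, deleting the first letter of a descending word from `j` leaves one from `i`.
  have : descWord j (k + 1) = j :: descWord i k := by
    rw [descWord, List.range_succ_eq_map, List.map_cons, List.map_map]
    simp only [Nat.sub_zero, List.cons.injEq, Fin.eta, true_and]
    refine List.map_congr_left fun t _ => Fin.ext ?_
    simp [hij]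
  rw [this]
  exact List.sublist_cons_self _ _

lemma ofFn_flatten_sublist {α : Type*} {f g : Fin n → List α} (h : ∀ i, (f i).Sublist (g i)) :
    (List.ofFn f).flatten.Sublist (List.ofFn g).flatten := by
  induction n with
  | zero => simp
  | succ n ih =>
    simp only [List.ofFn_succ, List.flatten_cons]
    exact (h 0).append (ih fun i => h i.succ)

lemma bruhatLE_of_invCode_le {z w : Perm (Fin (n + 1))} (h : invCode z ≤ invCode w) :
    BruhatLE (simple n) z w :=
  ⟨normalWord w, isReducedWord_normalWord w, normalWord z,
    ofFn_flatten_sublist fun i => descWord_sublist (h i.succ), isReducedWord_normalWord z⟩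

lemma bruhatLE_one (w : Perm (Fin (n + 1))) : BruhatLE (simple n) 1 w :=
  bruhatLE_of_invCode_le fun b => by simp

lemma isPrincipal_iff (w : Perm (Fin (n + 1))) :
    IsPrincipal (simple n) (lehmerCode n) w ↔
      ∀ z, BruhatLE (simple n) z w → invCode z ≤ invCode w := by
  simp only [IsPrincipal, codeInterval, bruhatInterval, Set.ext_iff, Set.mem_ofPred_eq,
    lehmerCode_eq_invCode, bruhatLE_one, true_and]
  have h1 (z : Perm (Fin (n + 1))) : invCode 1 ≤ invCode z := fun b => by simp
  simp only [h1, true_and]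
  exact ⟨fun h z => (h z).2, fun h z => ⟨bruhatLE_of_invCode_le, h z⟩⟩

/-! ### Bruhat order and rank functions -/

/-- The number of positions up to `p` at which `w` takes a value of at least `q`. -/
def rankCount (w : Perm (Fin m)) (p : Fin m) (q : ℕ) : ℕ := #{a | a ≤ p ∧ q ≤ w a}

lemma rankCount_simple_mul_of_ne (j : Fin n) (w : Perm (Fin (n + 1))) (p : Fin (n + 1)) {q : ℕ}
    (hq : q ≠ j + 1) : rankCount (simple n j * w) p q = rankCount w p q := by
  unfold rankCount
  congr 1
  ext a
  simp only [mem_filter, mem_univ, true_and, Perm.mul_apply, simple_apply_val]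
  split_ifs <;> omega

lemma rankCount_antitone (w : Perm (Fin m)) (p : Fin m) : Antitone (rankCount w p) := by
  intro q q' h
  refine card_le_card fun a => ?_
  simp only [mem_filter, mem_univ, true_and]
  omega

lemma rankCount_le_succ (w : Perm (Fin m)) (p : Fin m) (q : ℕ) :
    rankCount w p q ≤ rankCount w p (q + 1) + 1 := by
  by_cases hq : q < m
  · calc rankCount w p q
        ≤ #(insert (w⁻¹ ⟨q, hq⟩) (filter (fun a => a ≤ p ∧ q + 1 ≤ w a) univ)) := by
          refine card_le_card fun a => ?_
          simp only [mem_filter, mem_univ, true_and, mem_insert, Perm.eq_inv_iff_eq, Fin.ext_iff]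
          omega
      _ ≤ _ := card_insert_le _ _
  · have : rankCount w p q = 0 := by
      simp only [rankCount, card_eq_zero, filter_eq_empty_iff]
      intro a _
      have := (w a).2
      omega
    omega

lemma rankCount_eq_succ {w : Perm (Fin m)} {p q : Fin m} (h : p < w⁻¹ q) :
    rankCount w p q = rankCount w p (q + 1) := by
  unfold rankCount
  congr 1
  ext a
  simp only [mem_filter, mem_univ, true_and, and_congr_right_iff]
  intro ha
  have : w a ≠ q := by
    rintro rfl
    rw [show w⁻¹ (w a) = a from w.symm_apply_apply a] at h
    exact absurd ha h.not_ge
  have := Fin.val_ne_of_ne this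
  omega

lemma rankCount_eq_succ_add_one {w : Perm (Fin m)} {p q : Fin m} (h : w⁻¹ q ≤ p) :
    rankCount w p q = rankCount w p (q + 1) + 1 := by
  have : filter (fun a => a ≤ p ∧ (q : ℕ) ≤ w a) univ =
      insert (w⁻¹ q) (filter (fun a => a ≤ p ∧ (q : ℕ) + 1 ≤ w a) univ) := by
    ext a
    simp only [mem_filter, mem_univ, true_and, mem_insert, Perm.eq_inv_iff_eq]
    constructor
    · rintro ⟨ha, hq⟩
      rcases hq.eq_or_lt with h' | h'
      · exact Or.inl (Fin.ext h'.symm)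
      · exact Or.inr ⟨ha, h'⟩
    · rintro (rfl | ⟨ha, hq⟩)
      · exact ⟨by simpa using h, le_rfl⟩
      · exact ⟨ha, by omega⟩
  rw [rankCount, this, card_insert_of_notMem (by simp), rankCount]

/-- Only the threshold `j + 1` changes. There the rank of `simple n j * v` equals its rank at `j`,
or is one more than at `j + 2`, and the neighbouring bounds suffice. The threshold `j + 2` may equal
`n + 1`, hence `q : ℕ`. -/
lemma rankCount_le_simple_mul {j : Fin n} {x v : Perm (Fin (n + 1))}
    (hv : v⁻¹ j.castSucc < v⁻¹ j.succ)
    (h : ∀ p, ∀ q : ℕ, q ≠ j + 1 → rankCount x p q ≤ rankCount v p q) (p : Fin (n + 1)) (q : ℕ) :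
    rankCount x p q ≤ rankCount (simple n j * v) p q := by
  by_cases hq : q = j + 1
  · subst hq
    set y := simple n j * v with hy
    have hj : rankCount y p j = rankCount v p j := rankCount_simple_mul_of_ne j v p (by omega)
    have hj2 : rankCount y p (j + 1 + 1) = rankCount v p (j + 1 + 1) :=
      rankCount_simple_mul_of_ne j v p (by omega)
    have h1 := h p j (by omega)
    have h2 := h p (j + 1 + 1) (by omega)
    have h3 := rankCount_antitone x p (Nat.le_add_right j 1)
    have h4 := rankCount_le_succ x p (j + 1)
    have e1 : y⁻¹ j.castSucc = v⁻¹ j.succ := by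
      rw [hy, mul_inv_rev, Perm.mul_apply, simple_inv, simple_castSucc]
    have e2 : y⁻¹ j.succ = v⁻¹ j.castSucc := by
      rw [hy, mul_inv_rev, Perm.mul_apply, simple_inv, simple_succ]
    by_cases hp : p < v⁻¹ j.succ
    · have := rankCount_eq_succ (w := y) (p := p) (q := j.castSucc) (by rwa [e1])
      simp only [Fin.val_castSucc] at this
      omega
    · have := rankCount_eq_succ_add_one (w := y) (p := p) (q := j.succ)
        (by rw [e2]; exact hv.le.trans (not_lt.1 hp))
      simp only [Fin.val_succ] at this
      omega
  · rw [rankCount_simple_mul_of_ne j v p hq]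
    exact h p q hq

lemma rankCount_le_of_sublist {ω' ω : List (Fin n)} (h : ω'.Sublist ω)
    (hω : invNum (wordProd (simple n) ω) = ω.length) (p : Fin (n + 1)) (q : ℕ) :
    rankCount (wordProd (simple n) ω') p q ≤ rankCount (wordProd (simple n) ω) p q := by
  -- The tail of a reduced word is reduced, and its first letter is an ascent of the tail.
  have key (j : Fin n) (ω : List (Fin n))
      (hω : invNum (wordProd (simple n) (j :: ω)) = (j :: ω).length) :
      invNum (wordProd (simple n) ω) = ω.length ∧
        (wordProd (simple n) ω)⁻¹ j.castSucc < (wordProd (simple n) ω)⁻¹ j.succ := by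
    rw [wordProd_cons, List.length_cons] at hω
    have h1 := invNum_wordProd_le ω
    have h2 := invNum_simple_mul_le j (wordProd (simple n) ω)
    rw [← invNum_lt_simple_mul_iff]
    omega
  induction h generalizing p q with
  | slnil => rfl
  | cons j _ ih =>
    obtain ⟨h1, h2⟩ := key _ _ hω
    rw [wordProd_cons]
    exact rankCount_le_simple_mul h2 (fun p q _ => ih h1 p q) p q
  | cons_cons j _ ih =>
    obtain ⟨h1, h2⟩ := key _ _ hω
    rw [wordProd_cons, wordProd_cons]
    -- When the letter is kept on both sides, the smaller ranks change only at `j + 1`, where no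
    -- bound is required.
    refine rankCount_le_simple_mul h2 (fun p q hq => ?_) p q
    rw [rankCount_simple_mul_of_ne _ _ _ hq]
    exact ih h1 p q

lemma BruhatLE.rankCount_le {z w : Perm (Fin (n + 1))} (h : BruhatLE (simple n) z w)
    (p : Fin (n + 1)) (q : ℕ) : rankCount z p q ≤ rankCount w p q := by
  obtain ⟨ω, ⟨rfl, hω⟩, ω', hsub, rfl, -⟩ := h
  exact rankCount_le_of_sublist hsub (by rw [← length_eq_invNum, hω]) p q

/-! ### Pattern avoidance -/

lemma avoids_perm312_iff (w : Perm (Fin m)) :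
    Avoids w perm312 ↔
      ∀ a b c : Fin m, a < b → b < c → w⁻¹ c < w⁻¹ a → w⁻¹ a < w⁻¹ b → False := by
  constructor
  · intro h a b c hab hbc hca hac
    refine h ⟨![w⁻¹ c, w⁻¹ a, w⁻¹ b], ?_, ?_⟩
    · rw [Fin.strictMono_iff_lt_succ]
      intro i
      fin_cases i
      · exact hca
      · exact hac
    · rw [Fin.strictMono_iff_lt_succ]
      intro i
      fin_cases i
      · simpa [perm312, Perm.inv_def] using hab
      · simpa [perm312, Perm.inv_def] using hbc
  · rintro h ⟨i, hi, hw⟩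
    refine h (w (i 1)) (w (i 2)) (w (i 0)) ?_ ?_ ?_ ?_
    · exact hw (show (0 : Fin 3) < 1 by decide)
    · exact hw (show (1 : Fin 3) < 2 by decide)
    · simpa using hi (show (0 : Fin 3) < 1 by decide)
    · simpa using hi (show (1 : Fin 3) < 2 by decide)

lemma invCode_add_card (w : Perm (Fin m)) (b : Fin m) :
    invCode w b + #{a | a < b ∧ w⁻¹ a ≤ w⁻¹ b} = b := by
  have h := card_filter_add_card_filter_not (s := Iio b) (fun a => w⁻¹ b < w⁻¹ a)
  simp only [Fin.card_Iio, not_lt] at h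
  have e (p : Fin m → Prop) [DecidablePred p] :
      filter p (Iio b) = filter (fun a => a < b ∧ p a) univ := by ext; simp
  rw [e, e] at h
  exact h

lemma rankCount_add_card (w : Perm (Fin m)) (p b : Fin m) :
    rankCount w p b + #{a | a < b ∧ w⁻¹ a ≤ p} = p + 1 := by
  have h := card_filter_add_card_filter_not (s := Iic p) (fun a => b ≤ w a)
  rw [Fin.card_Iic] at h
  rw [← h]
  congr 1
  · unfold rankCount
    congr 1
    ext a
    simp only [mem_filter, mem_univ, true_and, mem_Iic, Fin.le_def]
  · rw [← card_map w.symm.toEmbedding (s := filter (fun a => a < b ∧ w⁻¹ a ≤ p) univ)]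
    congr 1
    ext a
    simp only [mem_filter, mem_univ, true_and, mem_map_equiv, mem_Iic, not_le, Equiv.symm_symm]
    rw [show w⁻¹ (w a) = a from w.symm_apply_apply a, and_comm]

lemma invCode_le_of_rankCount_le {z w : Perm (Fin m)} (hw : Avoids w perm312)
    (h : ∀ p, ∀ q : ℕ, rankCount z p q ≤ rankCount w p q) : invCode z ≤ invCode w := by
  rw [avoids_perm312_iff] at hw
  intro b
  change invCode z b ≤ invCode w b
  by_contra! hlt
  set p := z⁻¹ b with hp
  have h1 := invCode_add_card z b
  have h2 := invCode_add_card w b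
  have h3 := rankCount_add_card z p b
  have h4 := rankCount_add_card w p b
  have h5 := h p b
  rw [← hp] at h1
  -- Complementing both counts, `w` has too few letters below `b` up to `p`, so some `c < b` lies
  -- strictly between position `p` and `b`.
  have hcard : #{a | a < b ∧ w⁻¹ a ≤ p} < #{a | a < b ∧ w⁻¹ a ≤ w⁻¹ b} := by omega
  obtain ⟨c, hc, hc'⟩ := exists_mem_notMem_of_card_lt_card hcard
  simp only [mem_filter, mem_univ, true_and, not_and, not_le] at hc hc'
  have hpc := hc' hc.1
  have hcb : w⁻¹ c < w⁻¹ b := lt_of_le_of_ne hc.2 fun e => hc.1.ne (w⁻¹.injective e)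
  -- A value of at least `b` at a position up to `p` would form a 312 with `c` and `b`; yet `z` has
  -- `b` itself at `p`.
  have hzero : rankCount w p b = 0 := by
    simp only [rankCount, card_eq_zero, filter_eq_empty_iff, not_and, not_le]
    intro a _ hap
    by_contra! hba
    have hap' : a < w⁻¹ c := hap.trans_lt hpc
    refine hw c b (w a) hc.1 ?_ (by simpa using hap') hcb
    refine lt_of_le_of_ne (Fin.le_def.2 hba) ?_
    rintro rfl
    rw [show w⁻¹ (w a) = a from w.symm_apply_apply a] at hcb
    exact absurd (hap'.trans hcb) (lt_irrefl _)
  have hpos : 0 < rankCount z p b := by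
    refine card_pos.2 ⟨p, ?_⟩
    simp [hp]
  omega

lemma isPrincipal_of_avoids {w : Perm (Fin (n + 1))} (hw : Avoids w perm312) :
    IsPrincipal (simple n) (lehmerCode n) w :=
  (isPrincipal_iff w).2 fun _ hz => invCode_le_of_rankCount_le hw hz.rankCount_le

/-! ### Lazy Fubini words -/

lemma IsPrincipal.invCode_succ_le {w : Perm (Fin (n + 1))}
    (hw : IsPrincipal (simple n) (lehmerCode n) w) (i : Fin n) :
    invCode w i.succ ≤ invCode w i.castSucc + 1 := by
  rw [isPrincipal_iff] at hw
  by_contra! hlt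
  -- A jump of at least two cannot occur at `i = 0`, where the next entry is at most one.
  obtain ⟨j, hj⟩ : ∃ j : Fin n, (i : ℕ) = j + 1 := by
    have := invCode_le w i.succ
    rw [Fin.val_succ] at this
    exact ⟨⟨i - 1, by omega⟩, by simp only; omega⟩
  have hji : j.succ = i.castSucc := by simp [Fin.ext_iff, hj]
  have hk : invCode w i.castSucc + 1 ≤ j + 1 := by
    have := invCode_le w i.succ
    rw [Fin.val_succ] at this
    omega
  set k := invCode w i.castSucc + 1
  set z := wordProd (simple n) (descWord j k) with hz
  have hinv : invNum z = k := invNum_descWord j k hk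
  have hle : BruhatLE (simple n) z w := by
    refine ⟨normalWord w, isReducedWord_normalWord w, descWord j k, ?_, rfl, ?_⟩
    · refine (descWord_sublist_succ hj (show k + 1 ≤ invCode w i.succ by omega)).trans ?_
      exact List.sublist_flatten_of_mem (List.mem_ofFn.2 ⟨i, rfl⟩)
    · rw [length_eq_invNum, hinv, descWord_length]
  have : invCode z j.succ ≤ invCode w j.succ := hw z hle j.succ
  rw [← invNum_of_factor (descWord_fixesAbove j k hk) (descWord_increasingUpTo j k hk), ← hz,
    hinv, hji] at this
  omega

lemma isLazyFubini_iff {x : Fin (n + 1) → ℕ} (hx : ∀ i, x i ≤ i) :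
    IsLazyFubini x ↔ ∀ i : Fin n, x i.succ ≤ x i.castSucc + 1 :=
  ⟨fun h => h.2.2, fun h => ⟨fun i => (hx i).trans_lt i.2, Nat.le_zero.1 (hx 0), h⟩⟩

lemma avoids_of_isLazyFubini {w : Perm (Fin (n + 1))}
    (h : ∀ i : Fin n, invCode w i.succ ≤ invCode w i.castSucc + 1) : Avoids w perm312 := by
  rw [avoids_perm312_iff]
  intro a b c hab hbc hca hac
  induction c using Fin.induction with
  | zero => exact Fin.not_lt_zero b hbc
  | succ c ih =>
    -- Either the letter just below the largest can replace it in the pattern, or it stands after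
    -- `a`.
    by_cases hc : w⁻¹ c.castSucc < w⁻¹ a
    · refine ih (lt_of_le_of_ne (Fin.le_castSucc_iff.2 hbc) ?_) hc
      rintro rfl
      exact hc.asymm hac
    · have hacc : a < c.castSucc := hab.trans_le (Fin.le_castSucc_iff.2 hbc)
      have hc' : w⁻¹ a < w⁻¹ c.castSucc :=
        lt_of_le_of_ne (not_lt.1 hc) fun e => hacc.ne (w⁻¹.injective e)
      -- `c.succ` precedes everything counted for `c.castSucc`, and also `a` and `c.castSucc`, which
      -- are not counted there.
      have hlt : invCode w c.castSucc + 2 ≤ invCode w c.succ := by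
        have h1 : a ∉ filter (fun x => x < c.castSucc ∧ w⁻¹ c.castSucc < w⁻¹ x) univ := by
          simp only [mem_filter, mem_univ, true_and, not_and]
          exact fun _ => hc'.asymm
        have h2 : c.castSucc ∉
            insert a (filter (fun x => x < c.castSucc ∧ w⁻¹ c.castSucc < w⁻¹ x) univ) := by
          simp [hacc.ne']
        have h3 := card_insert_of_notMem h2
        rw [card_insert_of_notMem h1] at h3
        refine h3.symm.le.trans ?_
        refine card_le_card fun x => ?_
        simp only [mem_insert, mem_filter, mem_univ, true_and]
        rintro (rfl | rfl | ⟨hx, hx'⟩)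
        · exact ⟨Fin.castSucc_lt_succ, hca.trans hc'⟩
        · exact ⟨hacc.trans Fin.castSucc_lt_succ, hca⟩
        · exact ⟨hx.trans Fin.castSucc_lt_succ, (hca.trans hc').trans hx'⟩
      have := h c
      omega

lemma isLazyFubini_lehmerCode_iff (w : Perm (Fin (n + 1))) :
    IsLazyFubini (lehmerCode n w) ↔ ∀ i : Fin n, invCode w i.succ ≤ invCode w i.castSucc + 1 := by
  rw [lehmerCode_eq_invCode, isLazyFubini_iff (invCode_le w)]

lemma isPrincipal_iff_isLazyFubini (w : Perm (Fin (n + 1))) :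
    IsPrincipal (simple n) (lehmerCode n) w ↔ IsLazyFubini (lehmerCode n w) := by
  rw [isLazyFubini_lehmerCode_iff]
  exact ⟨fun h => h.invCode_succ_le, fun h => isPrincipal_of_avoids (avoids_of_isLazyFubini h)⟩

/-! ### Counting lazy Fubini words -/

/-- The words `x` of length `k + 1` with first letter `a` which never increase by more than one
in a step. -/
def lazyWords : (k : ℕ) → ℕ → Finset (Fin (k + 1) → ℕ)
  | 0, a => {fun _ => a}
  | k + 1, a => (range (a + 2)).biUnion fun b => (lazyWords k b).image (Fin.cons a)

lemma mem_lazyWords {k a : ℕ} {x : Fin (k + 1) → ℕ} :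
    x ∈ lazyWords k a ↔ x 0 = a ∧ ∀ i : Fin k, x i.succ ≤ x i.castSucc + 1 := by
  induction k generalizing a with
  | zero =>
    simp only [lazyWords, mem_singleton, IsEmpty.forall_iff, and_true]
    exact ⟨fun h => by rw [h], fun h => funext fun i => by rw [Subsingleton.elim (α := Fin 1) i 0, h]⟩
  | succ k ih =>
    simp only [lazyWords, mem_biUnion, mem_range, mem_image, ih]
    constructor
    · rintro ⟨b, hb, y, ⟨hy0, hy⟩, rfl⟩
      refine ⟨rfl, fun i => ?_⟩
      induction i using Fin.cases with
      | zero =>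
        simp only [Fin.cons_succ, Fin.castSucc_zero, Fin.cons_zero]
        omega
      | succ i => simpa [← Fin.succ_castSucc] using hy i
    · rintro ⟨rfl, hx⟩
      refine ⟨x 1, ?_, Fin.tail x, ⟨rfl, fun i => ?_⟩, Fin.cons_self_tail x⟩
      · have := hx 0
        simp only [Fin.succ_zero_eq_one, Fin.castSucc_zero] at this
        omega
      · simpa [Fin.tail, ← Fin.succ_castSucc] using hx i.succ

lemma card_lazyWords_succ (k a : ℕ) :
    #(lazyWords (k + 1) a) = ∑ b ∈ range (a + 2), #(lazyWords k b) := by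
  rw [lazyWords, card_biUnion]
  · exact sum_congr rfl fun b _ => card_image_of_injective _ (Fin.cons_right_injective (α := fun _ => ℕ) a)
  · intro b _ c _ hbc
    rw [Function.onFun, Finset.disjoint_left]
    simp only [mem_image, mem_lazyWords]
    rintro _ ⟨y, ⟨hy, -⟩, rfl⟩ ⟨z, ⟨hz, -⟩, h⟩
    have := Fin.cons_right_injective (α := fun _ => ℕ) a h
    subst this
    exact hbc (hy.symm.trans hz)

/-- Ballot numbers as differences of adjacent binomials, written additively. Splitting off the
largest second letter turns the recursion into Pascal's rule. -/
lemma card_lazyWords_add_choose (k a : ℕ) :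
    #(lazyWords (k + 1) a) + (2 * k + a + 3).choose k = (2 * k + a + 3).choose (k + 1) := by
  induction k generalizing a with
  | zero =>
    rw [card_lazyWords_succ]
    simp [lazyWords]
  | succ k ihk =>
    induction a with
    | zero =>
      have h0 := ihk 0
      have h1 := ihk 1
      rw [card_lazyWords_succ, sum_range_succ, sum_range_one]
      have e1 := Nat.choose_succ_succ (2 * k + 4) k
      have e2 := Nat.choose_succ_succ (2 * k + 4) (k + 1)
      have e3 := Nat.choose_succ_succ (2 * k + 3) k
      have e4 := Nat.choose_succ_succ (2 * k + 3) (k + 1)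
      -- At `a = 0` the recursion has no smaller case; symmetry of the middle binomials closes it.
      have e5 : (2 * k + 3).choose (k + 2) = (2 * k + 3).choose (k + 1) :=
        Nat.choose_symm_of_eq_add (by ring)
      simp only [Nat.succ_eq_add_one, add_assoc, Nat.reduceAdd, mul_add, mul_one] at *
      omega
    | succ a iha =>
      have h1 := ihk (a + 2)
      rw [card_lazyWords_succ, sum_range_succ, ← card_lazyWords_succ]
      have e1 := Nat.choose_succ_succ (2 * k + a + 5) k
      have e2 := Nat.choose_succ_succ (2 * k + a + 5) (k + 1)
      have r1 : 2 * (k + 1) + a + 3 = 2 * k + a + 5 := by ring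
      have r2 : 2 * k + (a + 2) + 3 = 2 * k + a + 5 := by ring
      have r3 : 2 * (k + 1) + (a + 1) + 3 = 2 * k + a + 5 + 1 := by ring
      rw [r1] at iha
      rw [r2] at h1
      rw [r3]
      simp only [Nat.succ_eq_add_one] at *
      have r4 : a + 1 + 1 = a + 2 := rfl
      rw [r4]
      omega

lemma card_lazyWords_zero (k : ℕ) : #(lazyWords k 0) = catalan (k + 1) := by
  cases k with
  | zero => simp [lazyWords]
  | succ k =>
    have h := card_lazyWords_add_choose k 0
    have hc := succ_mul_catalan_eq_centralBinom (k + 2)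
    have e1 := Nat.choose_succ_succ (2 * k + 3) (k + 1)
    have e5 : (2 * k + 3).choose (k + 2) = (2 * k + 3).choose (k + 1) :=
      Nat.choose_symm_of_eq_add (by ring)
    have e6 := Nat.choose_succ_right_eq (2 * k + 3) k
    have r : 2 * (k + 2) = 2 * k + 3 + 1 := by ring
    have r2 : 2 * k + 3 - k = k + 3 := by omega
    rw [Nat.centralBinom, r] at hc
    rw [r2] at e6
    simp only [Nat.succ_eq_add_one, add_assoc, Nat.reduceAdd, add_zero] at *
    have : (k + 3) * #(lazyWords (k + 1) 0) = (k + 3) * catalan (k + 2) := by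
      rw [hc, e1, e5]
      nlinarith
    exact Nat.eq_of_mul_eq_mul_left (by omega) this

lemma le_val_of_lazy {x : Fin (n + 1) → ℕ} (h0 : x 0 = 0)
    (h : ∀ i : Fin n, x i.succ ≤ x i.castSucc + 1) (i : Fin (n + 1)) : x i ≤ i := by
  induction i using Fin.induction with
  | zero => simp [h0]
  | succ i ih =>
    have := h i
    simp only [Fin.val_castSucc, Fin.val_succ] at *
    omega

lemma ncard_isPrincipal (n : ℕ) :
    Set.ncard {w : Perm (Fin (n + 1)) | IsPrincipal (simple n) (lehmerCode n) w} =
      catalan (n + 1) := by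
  rw [← card_lazyWords_zero, ← Set.ncard_coe_finset,
    ← Set.ncard_image_of_injective _ invCode_injective]
  congr 1
  ext x
  simp only [Set.mem_image, Set.mem_ofPred_eq, isPrincipal_iff_isLazyFubini,
    isLazyFubini_lehmerCode_iff, mem_coe, mem_lazyWords]
  constructor
  · rintro ⟨w, hw, rfl⟩
    exact ⟨invCode_zero w, hw⟩
  · rintro ⟨h0, h⟩
    obtain ⟨w, rfl⟩ := exists_invCode_eq x (le_val_of_lazy h0 h)
    exact ⟨w, h, rfl⟩

end LehmerCode

theorem mainTheorem11 (n : ℕ) :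
    (∀ w : Equiv.Perm (Fin (n + 1)),
      List.TFAE
        [LehmerCode.IsPrincipal (LehmerCode.simple n) (LehmerCode.lehmerCode n) w,
         LehmerCode.IsLazyFubini (LehmerCode.lehmerCode n w),
         LehmerCode.Avoids w LehmerCode.perm312]) ∧
    Set.ncard {w : Equiv.Perm (Fin (n + 1)) |
      LehmerCode.IsPrincipal (LehmerCode.simple n) (LehmerCode.lehmerCode n) w} =
        catalan (n + 1) := by
  refine ⟨fun w => ?_, LehmerCode.ncard_isPrincipal n⟩
  tfae_have 1 ↔ 2 := LehmerCode.isPrincipal_iff_isLazyFubini w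
  tfae_have 2 → 3 := fun h =>
    LehmerCode.avoids_of_isLazyFubini ((LehmerCode.isLazyFubini_lehmerCode_iff w).1 h)
  tfae_have 3 → 1 := LehmerCode.isPrincipal_of_avoids
  tfae_finish
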